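/- For $f\colon\{\pm1\}^n\to\mathbb{R}$ and $S\subseteq[n]$ let $\hat f(S)=\mathbb{E}_x\big[f(x)\prod_{i\in S}x_i\big]$, where $x$ is uniform on $\{\pm1\}^n$, and let $L_{1,\ell}(f)=\sum_{S\subseteq[n],\,|S|=\ell}|\hat f(S)|$. A parity decision tree $\mathcal{T}$ on $n$ variables is a rooted binary tree in which every internal node $v$ is labeled by a non-empty set $Q_v\subseteq[n]$ whose indicator vector is not in the $\mathbb{F}_2$-span of those of the labels of its proper ancestors, the two outgoing edges of every internal node are labeled $+1$ and $-1$, and the leaves are labeled by $0$ or $1$. On input $x\in\{\pm1\}^n$ one starts at the root, follows at each internal node $v$ the edge labeled $\prod_{i\in Q_v}x_i$, and outputs the label $\mathcal{T}(x)\in\{0,1\}$ of the leaf that is reached. The depth of $\mathcal{T}$ is the maximum number of edges on a root-to-leaf path. **Theorem.** There are universal constants $C,C'>0$ such that the following holds. Let $\ell\ge1$ be an integer, let $\mathcal{T}$ be a parity decision tree of depth $d$ on $n\ge\max\{d,\ell\}$ variables, and suppose that $p=\Pr_x[\mathcal{T}(x)=1]\ge2^{-d}$, where $x$ is uniform on $\{\pm1\}^n$.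 Then, with $\log=\log_2$, $$ L_{1,\ell}(\mathcal{T})\ \le\ p\cdot\min\left\{\binom{d\ell}{\ell},\;2^d-1,\;\Big(C\sqrt d\,\log\frac{n^\ell}{p}\Big)^{\ell}\right\}, $$ and, if $n\ge2$, the right-hand side is at most $\big(C'\sqrt d\,\ell\,\log n\big)^{\ell}$. -/

import Mathlib

/-- A point of the cube `{±1}ⁿ`. -/
abbrev SignCube (n : ℕ) : Type := Fin n → ℤˣ

/-- The character `x_S = ∏_{i ∈ S} x_i`, with value in `{±1}`. -/
def parityChar {n : ℕ} (S : Finset (Fin n)) (x : SignCube n) : ℤˣ := ∏ i ∈ S, x i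

/-- The Fourier coefficient `E_x[f(x) x_S]`, where `x` is uniform on `{±1}ⁿ`. -/
noncomputable def fourierCoeffCube {n : ℕ} (f : SignCube n → ℝ) (S : Finset (Fin n)) : ℝ :=
  (∑ x : SignCube n, f x * ((parityChar S x : ℤ) : ℝ)) / 2 ^ n

/-- The level-`ℓ` Fourier mass: the sum of `|E_x[f(x) x_S]|` over all `S ⊆ [n]` of size `ℓ`. -/
noncomputable def levelMass {n : ℕ} (l : ℕ) (f : SignCube n → ℝ) : ℝ :=
  ∑ S ∈ Finset.powersetCard l (Finset.univ : Finset (Fin n)), |fourierCoeffCube f S|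

/-- Binary trees whose internal nodes are labeled by sets `Q ⊆ [n]` and whose leaves are labeled
by `0` (`false`) or `1` (`true`). In `node Q pos neg` the subtree `pos` hangs on the edge labeled
`+1` and `neg` on the edge labeled `-1`. -/
inductive ParityTree (n : ℕ) : Type
  | leaf (b : Bool) : ParityTree n
  | node (Q : Finset (Fin n)) (pos neg : ParityTree n) : ParityTree n

/-- The indicator vector of `Q ⊆ [n]` over the field with two elements. -/
def parityVec {n : ℕ} (Q : Finset (Fin n)) : Fin n → ZMod 2 := fun i => if i ∈ Q then 1 else 0

namespace ParityTree

/-- The label of the leaf reached by the computation path of `x`. -/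
def output {n : ℕ} : ParityTree n → SignCube n → Bool
  | leaf b, _ => b
  | node Q pos neg, x => if parityChar Q x = 1 then pos.output x else neg.output x

/-- The maximum depth of a leaf; the root has depth `0`. -/
def depth {n : ℕ} : ParityTree n → ℕ
  | leaf _ => 0
  | node _ pos neg => max pos.depth neg.depth + 1

/-- Validity of a subtree whose root has the queries in `A` at its proper ancestors: every query
is a non-empty set that is not implied by the queries at its ancestors, that is, its indicator
vector is not in the span of theirs over the field with two elements. -/
def ValidBelow {n : ℕ} : Set (Finset (Fin n)) → ParityTree n → Prop
  | _, leaf _ => True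
  | A, node Q pos neg =>
      Q.Nonempty ∧ parityVec Q ∉ Submodule.span (ZMod 2) (parityVec '' A) ∧
        ValidBelow (insert Q A) pos ∧ ValidBelow (insert Q A) neg

/-- The trees that are parity decision trees: every query is non-empty and is not implied by the
queries at its ancestors. -/
def IsPDT {n : ℕ} (T : ParityTree n) : Prop := ValidBelow ∅ T

/-- The function `{±1}ⁿ → {0,1}` computed by the tree, as a real function. -/
def eval {n : ℕ} (T : ParityTree n) (x : SignCube n) : ℝ := if T.output x = true then 1 else 0

/-- The probability that the tree outputs `1` on a uniformly random input. -/
noncomputable def acceptProb {n : ℕ} (T : ParityTree n) : ℝ :=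
  ((Finset.univ.filter fun x : SignCube n => T.output x = true).card : ℝ) / 2 ^ n

end ParityTree

/-! The leaves cut the cube into affine subspaces. If the queries above a leaf span `V`, of
dimension at most d, then on that leaf x_S is constant for S in `V` and has mean zero otherwise. So
a 1-leaf contributes at most its probability times the number of weight-ℓ vectors in `V`. There are
at most 2^d - 1 of these, and at most binom(dℓ, ℓ), because a basis chosen among them covers at most
dℓ coordinates and hence contains the supports of all of them.

For the third bound, signs a_S turn the mass into E[T(x) h(x)] with h = ∑ a_S x_S. After each query
further coordinates are fixed until the span is clean: every vector of weight at most k = 2mℓ in it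
is supported on the set F of fixed coordinates (`exists_isClean_sup`). The excess dim V - |F| grows
by at most one per query, and a short vector lowers it by at least one at the cost of at most k
coordinates, so a path fixes at most kd coordinates. At a leaf h has the same mean as its part g
supported on F.

Since the span is clean before each batch, functions of degree at most k, such as 2m-th powers of
degree-ℓ polynomials, average as if the new coordinates were independent and uniform
(`IsClean.sum_eq_sum_mixAt`). Fixing x_i replaces the walk value W_R by W_R + x_i W_{R ∪ i}, and a
two-point hypercontractive inequality bounds the new moments at level |R| by the old ones at levels
|R| and |R| + 1. Unrolling gives E g^{2m} ≤ 3^m (8m(1 + kd))^{mℓ} n^ℓ. By Hölder, mass^{2m} ≤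
p^{2m-1} E g^{2m}, and m ≈ log(n^ℓ/p)/ℓ finishes. -/

open Finset

/-! ### Characters of the cube -/

section Character

variable {n : ℕ}

/-- The character `x_S` as a real number. -/
def realChar (S : Finset (Fin n)) (x : SignCube n) : ℝ := ((parityChar S x : ℤ) : ℝ)

lemma parityChar_symmDiff (S T : Finset (Fin n)) (x : SignCube n) :
    parityChar (symmDiff S T) x = parityChar S x * parityChar T x := by
  have hST : Disjoint (S \ T) (T \ S) := disjoint_sdiff_sdiff
  have h1 : parityChar (symmDiff S T) x = parityChar (S \ T) x * parityChar (T \ S) x := by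
    unfold parityChar
    rw [← prod_union hST]; rfl
  have h2 : parityChar S x = parityChar (S \ T) x * parityChar (S ∩ T) x := by
    unfold parityChar
    rw [← prod_union (disjoint_sdiff_inter S T), sdiff_union_inter]
  have h3 : parityChar T x = parityChar (T \ S) x * parityChar (S ∩ T) x := by
    unfold parityChar
    rw [inter_comm, ← prod_union (disjoint_sdiff_inter T S), sdiff_union_inter]
  rw [h1, h2, h3, mul_mul_mul_comm, Int.units_mul_self, mul_one]

lemma realChar_symmDiff (S T : Finset (Fin n)) (x : SignCube n) :
    realChar (symmDiff S T) x = realChar S x * realChar T x := by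
  simp [realChar, parityChar_symmDiff]

lemma realChar_empty (x : SignCube n) : realChar ∅ x = 1 := by simp [realChar, parityChar]

lemma realChar_eq_prod (S : Finset (Fin n)) (x : SignCube n) :
    realChar S x = ∏ i ∈ S, ((x i : ℤ) : ℝ) := by
  simp [realChar, parityChar]

lemma realChar_insert {S : Finset (Fin n)} {i : Fin n} (hi : i ∉ S) (x : SignCube n) :
    realChar (insert i S) x = ((x i : ℤ) : ℝ) * realChar S x := by
  simp [realChar_eq_prod, prod_insert hi]

lemma abs_realChar (S : Finset (Fin n)) (x : SignCube n) : |realChar S x| = 1 := by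
  rcases Int.units_eq_one_or (parityChar S x) with h | h <;> simp [realChar, h]

/-- The point `x` with its `i`-th coordinate negated. -/
def flipAt (i : Fin n) (x : SignCube n) : SignCube n := Function.update x i (-x i)

lemma flipAt_involutive (i : Fin n) : Function.Involutive (flipAt i) := by
  intro x
  simp [flipAt]

lemma sum_flipAt (i : Fin n) (g : SignCube n → ℝ) : ∑ x, g (flipAt i x) = ∑ x, g x :=
  Equiv.sum_comp (flipAt_involutive i).toPerm g

lemma realChar_congr {S : Finset (Fin n)} {x y : SignCube n} (h : ∀ i ∈ S, x i = y i) :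
    realChar S x = realChar S y := by
  rw [realChar_eq_prod, realChar_eq_prod]
  exact prod_congr rfl fun i hi => by rw [h i hi]

lemma realChar_flipAt_of_notMem {S : Finset (Fin n)} {i : Fin n} (hi : i ∉ S) (x : SignCube n) :
    realChar S (flipAt i x) = realChar S x :=
  realChar_congr fun j hj => by
    rw [flipAt, Function.update_of_ne]; rintro rfl; exact hi hj

lemma realChar_flipAt_of_mem {S : Finset (Fin n)} {i : Fin n} (hi : i ∈ S) (x : SignCube n) :
    realChar S (flipAt i x) = -realChar S x := by
  rw [← insert_erase hi, realChar_insert (notMem_erase i S), realChar_insert (notMem_erase i S),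
    realChar_flipAt_of_notMem (notMem_erase i S)]
  simp [flipAt]

lemma sum_realChar_eq_zero {S : Finset (Fin n)} (hS : S.Nonempty) :
    ∑ x : SignCube n, realChar S x = 0 := by
  obtain ⟨i, hi⟩ := hS
  have h := sum_flipAt i (realChar S)
  simp only [realChar_flipAt_of_mem hi, sum_neg_distrib] at h
  linarith

end Character

/-! ### Indicator vectors and coordinate subspaces over the two-element field -/

section ParityVec

variable {n : ℕ}

lemma parityVec_symmDiff (S T : Finset (Fin n)) :
    parityVec (symmDiff S T) = parityVec S + parityVec T := by
  funext i
  by_cases h1 : i ∈ S <;> by_cases h2 : i ∈ T <;>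
    simp [parityVec, mem_symmDiff, h1, h2, CharTwo.add_self_eq_zero]

lemma parityVec_injective : Function.Injective (parityVec (n := n)) := by
  intro S T h
  ext i
  have := congrFun h i
  by_cases h1 : i ∈ S <;> by_cases h2 : i ∈ T <;> simp_all [parityVec]

lemma parityVec_empty : parityVec (∅ : Finset (Fin n)) = 0 := by
  funext i; simp [parityVec]

lemma parityVec_singleton (i : Fin n) : parityVec {i} = Pi.single i 1 := by
  funext j; simp [parityVec, Pi.single_apply]

lemma parityVec_eq_sum (S : Finset (Fin n)) : parityVec S = ∑ i ∈ S, parityVec {i} := by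
  funext j
  simp [parityVec, Finset.sum_apply]

lemma parityVec_add_self (Q : Finset (Fin n)) : parityVec Q + parityVec Q = 0 := by
  rw [← parityVec_symmDiff, symmDiff_self, bot_eq_empty, parityVec_empty]

lemma mem_sup_span_parityVec {V : Submodule (ZMod 2) (Fin n → ZMod 2)} {S Q : Finset (Fin n)} :
    parityVec S ∈ V ⊔ Submodule.span (ZMod 2) {parityVec Q} ↔
      parityVec S ∈ V ∨ parityVec (symmDiff S Q) ∈ V := by
  rw [parityVec_symmDiff, Submodule.mem_sup]
  constructor
  · rintro ⟨v, hv, w, hw, h⟩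
    obtain ⟨c, rfl⟩ := Submodule.mem_span_singleton.1 hw
    have hc : ∀ c : ZMod 2, c = 0 ∨ c = 1 := by decide
    rcases hc c with rfl | rfl
    · left; rw [← h]; simpa using hv
    · right
      rw [← h, one_smul, add_assoc, parityVec_add_self, add_zero]; exact hv
  · rintro (h | h)
    · exact ⟨_, h, 0, zero_mem _, add_zero _⟩
    · exact ⟨_, h, _, Submodule.mem_span_singleton_self _, by
        rw [add_assoc, parityVec_add_self, add_zero]⟩

/-- The span of the unit vectors of the coordinates in `F`. -/
def coordSpan (F : Finset (Fin n)) : Submodule (ZMod 2) (Fin n → ZMod 2) :=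
  Submodule.span (ZMod 2) ((fun i => parityVec {i}) '' (F : Set (Fin n)))

lemma coordSpan_insert (i : Fin n) (F : Finset (Fin n)) :
    coordSpan (insert i F) = coordSpan F ⊔ Submodule.span (ZMod 2) {parityVec {i}} := by
  rw [coordSpan, coe_insert, Set.image_insert_eq, Submodule.span_insert, sup_comm]; rfl

lemma coordSpan_le {F : Finset (Fin n)} {V : Submodule (ZMod 2) (Fin n → ZMod 2)} :
    coordSpan F ≤ V ↔ ∀ i ∈ F, parityVec {i} ∈ V := by
  rw [coordSpan, Submodule.span_le]
  simp [Set.subset_def]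

lemma parityVec_singleton_mem_coordSpan {F : Finset (Fin n)} {i : Fin n} (hi : i ∈ F) :
    parityVec {i} ∈ coordSpan F :=
  coordSpan_le.1 le_rfl i hi

lemma finrank_coordSpan (F : Finset (Fin n)) :
    Module.finrank (ZMod 2) (coordSpan F) = F.card := by
  have h : LinearIndependent (ZMod 2) fun i : F => parityVec ({(i : Fin n)} : Finset (Fin n)) := by
    have := (Pi.basisFun (ZMod 2) (Fin n)).linearIndependent.comp
      (fun i : F => (i : Fin n)) Subtype.val_injective
    convert this using 1
    funext i
    simp [parityVec_singleton]
  have h2 := finrank_span_eq_card h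
  rw [Fintype.card_coe] at h2
  rw [← h2, coordSpan]
  have : (fun i => parityVec {i}) '' (F : Set (Fin n)) =
      Set.range fun i : F => parityVec ({(i : Fin n)} : Finset (Fin n)) := by
    ext v; simp
  rw [this]

lemma finrank_sup_coordSpan_le (V : Submodule (ZMod 2) (Fin n → ZMod 2)) (F : Finset (Fin n)) :
    Module.finrank (ZMod 2) ↥(V ⊔ coordSpan F) ≤ Module.finrank (ZMod 2) V + F.card := by
  rw [← finrank_coordSpan F]
  exact Submodule.finrank_add_le_finrank_add_finrank _ _

lemma finrank_sup_span_singleton_le (V : Submodule (ZMod 2) (Fin n → ZMod 2))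
    (v : Fin n → ZMod 2) :
    Module.finrank (ZMod 2) ↥(V ⊔ Submodule.span (ZMod 2) {v}) ≤
      Module.finrank (ZMod 2) V + 1 := by
  refine (Submodule.finrank_add_le_finrank_add_finrank _ _).trans ?_
  have : Module.finrank (ZMod 2) (Submodule.span (ZMod 2) {v}) ≤ 1 := by
    simpa using finrank_span_le_card (R := ZMod 2) ({v} : Set (Fin n → ZMod 2))
  omega

end ParityVec

/-! ### Affine subspaces seen through their characters -/

section Affine

variable {n : ℕ}

/-- `H` behaves as a (possibly empty) affine subspace with annihilator `V`: the characters in `V`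
are constant on `H`, and all others are balanced on `H`. -/
structure IsAffine (H : Finset (SignCube n)) (V : Submodule (ZMod 2) (Fin n → ZMod 2)) :
    Prop where
  const : ∀ S, parityVec S ∈ V → ∀ x ∈ H, ∀ y ∈ H, parityChar S x = parityChar S y
  sum_eq_zero : ∀ S, parityVec S ∉ V → ∑ x ∈ H, realChar S x = 0

lemma isAffine_empty (V : Submodule (ZMod 2) (Fin n → ZMod 2)) : IsAffine ∅ V :=
  ⟨by simp, by simp⟩

lemma isAffine_univ : IsAffine (univ : Finset (SignCube n)) ⊥ := by
  refine ⟨fun S hS => ?_, fun S hS => ?_⟩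
  · rw [Submodule.mem_bot, ← parityVec_empty] at hS
    rw [parityVec_injective hS]; simp [parityChar]
  · apply sum_realChar_eq_zero
    rw [nonempty_iff_ne_empty]
    rintro rfl
    exact hS (by simp [parityVec_empty])

lemma IsAffine.filter {H : Finset (SignCube n)} {V : Submodule (ZMod 2) (Fin n → ZMod 2)}
    (h : IsAffine H V) (Q : Finset (Fin n)) (b : ℤˣ) :
    IsAffine (H.filter fun x => parityChar Q x = b)
      (V ⊔ Submodule.span (ZMod 2) {parityVec Q}) := by
  refine ⟨fun S hS x hx y hy => ?_, fun S hS => ?_⟩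
  · rw [mem_filter] at hx hy
    rcases mem_sup_span_parityVec.1 hS with h1 | h1
    · exact h.const S h1 x hx.1 y hy.1
    · have := h.const _ h1 x hx.1 y hy.1
      rw [parityChar_symmDiff, parityChar_symmDiff, hx.2, hy.2] at this
      exact mul_right_cancel this
  · rw [mem_sup_span_parityVec, not_or] at hS
    have h1 := h.sum_eq_zero _ hS.1
    have h2 := h.sum_eq_zero _ hS.2
    -- The indicator of x_Q = b is (1 + b x_Q)/2, so a character sum over the half is a combination
    -- of the sums for S and S △ Q, both balanced.
    have key : ∀ x, (if parityChar Q x = b then realChar S x else 0) =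
        (1 / 2) * realChar S x + (((b : ℤ) : ℝ) / 2) * realChar (symmDiff S Q) x := by
      intro x
      rw [realChar_symmDiff]
      rcases Int.units_eq_one_or b with hb | hb <;>
        rcases Int.units_eq_one_or (parityChar Q x) with hq | hq <;>
        simp [realChar, hb, hq] <;> ring
    rw [sum_filter, sum_congr rfl fun x _ => key x, sum_add_distrib, ← mul_sum, ← mul_sum, h1, h2]
    simp

lemma IsAffine.filter_coord {H : Finset (SignCube n)}
    {V : Submodule (ZMod 2) (Fin n → ZMod 2)} (h : IsAffine H V) (F : Finset (Fin n))
    (z : SignCube n) :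
    IsAffine (H.filter fun x => ∀ i ∈ F, x i = z i) (V ⊔ coordSpan F) := by
  induction F using Finset.induction_on with
  | empty => simpa [coordSpan] using h
  | insert i F hi ih =>
    rw [coordSpan_insert, ← sup_assoc]
    convert ih.filter {i} (z i) using 1
    ext x
    simp only [mem_filter, mem_insert, parityChar, prod_singleton]
    aesop

end Affine

/-! ### Counting short vectors: the first two bounds -/

section Counting

variable {n : ℕ}

/-- The sets of size `l` whose indicator vectors lie in `V`. -/
noncomputable def levelSets (l : ℕ) (V : Submodule (ZMod 2) (Fin n → ZMod 2)) :
    Finset (Finset (Fin n)) :=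
  by classical exact (powersetCard l univ).filter fun S => parityVec S ∈ V

lemma mem_levelSets {l : ℕ} {V : Submodule (ZMod 2) (Fin n → ZMod 2)} {S : Finset (Fin n)} :
    S ∈ levelSets l V ↔ S.card = l ∧ parityVec S ∈ V := by
  simp [levelSets]

lemma card_levelSets_le_two_pow {l d : ℕ} (hl : 1 ≤ l)
    {V : Submodule (ZMod 2) (Fin n → ZMod 2)} (hV : Module.finrank (ZMod 2) V ≤ d) :
    (levelSets l V).card ≤ 2 ^ d - 1 := by
  classical
  have h1 : (levelSets l V).card ≤ ((univ.filter fun v => v ∈ V).erase 0).card := by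
    refine card_le_card_of_injOn parityVec (fun S hS => ?_) parityVec_injective.injOn
    rw [mem_coe, mem_levelSets] at hS
    rw [mem_coe, mem_erase, mem_filter]
    refine ⟨fun h0 => ?_, mem_univ _, hS.2⟩
    rw [← parityVec_empty] at h0
    rw [parityVec_injective h0, card_empty] at hS
    omega
  have h2 : (univ.filter fun v => v ∈ V).card = 2 ^ Module.finrank (ZMod 2) V := by
    have := Module.card_eq_pow_finrank (K := ZMod 2) (V := V)
    rw [ZMod.card, Fintype.card_subtype] at this
    exact this
  rw [card_erase_of_mem (by simp), h2] at h1
  have := Nat.pow_le_pow_right (n := 2) (by norm_num) hV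
  omega

/-- At most d of these vectors form a basis of their span. A coordinate outside the union of the
basis supports vanishes on the whole span. -/
lemma card_levelSets_le_choose {l d : ℕ}
    {V : Submodule (ZMod 2) (Fin n → ZMod 2)} (hV : Module.finrank (ZMod 2) V ≤ d) :
    (levelSets l V).card ≤ (d * l).choose l := by
  classical
  obtain ⟨b, hb, hspan, hli⟩ :=
    exists_linearIndependent (ZMod 2) (parityVec '' (levelSets l V : Set (Finset (Fin n))))
  set B := (levelSets l V).filter fun S => parityVec S ∈ b with hB
  have hbB : b = (B.image parityVec : Finset (Fin n → ZMod 2)) := by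
    ext v
    simp only [coe_image, Set.mem_image, mem_coe, hB, mem_filter]
    constructor
    · intro hv
      obtain ⟨S, hS, rfl⟩ := hb hv
      exact ⟨S, ⟨hS, hv⟩, rfl⟩
    · rintro ⟨S, hS, rfl⟩
      exact hS.2
  have hBcard : B.card ≤ d := by
    rw [← card_image_of_injective B parityVec_injective]
    rw [hbB] at hli
    have h1 := finrank_span_finset_eq_card (R := ZMod 2) (s := B.image parityVec) hli
    rw [← h1, ← hbB, hspan]
    refine (Submodule.finrank_mono (Submodule.span_le.2 ?_)).trans hV
    rintro _ ⟨S, hS, rfl⟩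
    exact (mem_levelSets.1 hS).2
  set U := B.biUnion id
  have hU : U.card ≤ d * l := by
    refine (card_biUnion_le_card_mul B id l fun S hS => ?_).trans (Nat.mul_le_mul_right l hBcard)
    exact (mem_levelSets.1 (mem_filter.1 hS).1).1.le
  have hsub : levelSets l V ⊆ powersetCard l U := by
    intro S hS
    rw [mem_powersetCard]
    refine ⟨fun i hi => ?_, (mem_levelSets.1 hS).1⟩
    by_contra hiU
    have hle : Submodule.span (ZMod 2) b ≤ LinearMap.ker (LinearMap.proj (R := ZMod 2)
        (φ := fun _ : Fin n => ZMod 2) i) := by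
      rw [Submodule.span_le, hbB]
      intro v hv
      obtain ⟨S', hS', rfl⟩ := mem_image.1 hv
      have : i ∉ S' := fun h => hiU (mem_biUnion.2 ⟨S', hS', h⟩)
      simp [parityVec, this]
    have hmem : parityVec S ∈ Submodule.span (ZMod 2) b := by
      rw [hspan]; exact Submodule.subset_span ⟨S, hS, rfl⟩
    simpa [parityVec, hi] using hle hmem
  calc (levelSets l V).card ≤ (powersetCard l U).card := card_le_card hsub
    _ = U.card.choose l := card_powersetCard _ _
    _ ≤ _ := Nat.choose_le_choose l hU

lemma ParityTree.eval_node (Q : Finset (Fin n)) (pos neg : ParityTree n) (x : SignCube n) :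
    (ParityTree.node Q pos neg).eval x =
      if parityChar Q x = 1 then pos.eval x else neg.eval x := by
  unfold ParityTree.eval
  rw [ParityTree.output]
  split_ifs <;> rfl

lemma sum_filter_parityChar (H : Finset (SignCube n)) (Q : Finset (Fin n)) (g : SignCube n → ℝ) :
    ∑ x ∈ H, g x = ∑ x ∈ H.filter (fun x => parityChar Q x = 1), g x +
      ∑ x ∈ H.filter (fun x => parityChar Q x = -1), g x := by
  rw [← sum_filter_add_sum_filter_not H (fun x => parityChar Q x = 1)]
  congr 2
  ext x
  simp only [mem_filter]
  rcases Int.units_eq_one_or (parityChar Q x) with h | h <;> simp [h]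

lemma sum_node_eq (H : Finset (SignCube n)) (Q : Finset (Fin n)) (pos neg : ParityTree n)
    (g : SignCube n → ℝ) :
    ∑ x ∈ H, (ParityTree.node Q pos neg).eval x * g x =
      ∑ x ∈ H.filter (fun x => parityChar Q x = 1), pos.eval x * g x +
      ∑ x ∈ H.filter (fun x => parityChar Q x = -1), neg.eval x * g x := by
  rw [sum_filter_parityChar H Q]
  congr 1 <;> refine sum_congr rfl fun x hx => ?_ <;> rw [mem_filter] at hx <;>
    simp [ParityTree.eval_node, hx.2]

theorem sum_abs_eval_le_of_card_levelSets_le {l D N : ℕ}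
    (hN : ∀ V : Submodule (ZMod 2) (Fin n → ZMod 2), Module.finrank (ZMod 2) V ≤ D →
      (levelSets l V).card ≤ N)
    (T : ParityTree n) (H : Finset (SignCube n)) (V : Submodule (ZMod 2) (Fin n → ZMod 2))
    (hH : IsAffine H V) (hD : Module.finrank (ZMod 2) V + T.depth ≤ D) :
    ∑ S ∈ powersetCard l univ, |∑ x ∈ H, T.eval x * realChar S x| ≤
      (∑ x ∈ H, T.eval x) * N := by
  induction T generalizing H V with
  | leaf b =>
    cases b with
    | false => simp [ParityTree.eval, ParityTree.output]
    | true =>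
      simp only [ParityTree.eval, ParityTree.output, if_true, one_mul, sum_const, nsmul_eq_mul,
        mul_one]
      have h1 : ∑ S ∈ powersetCard l univ, |∑ x ∈ H, realChar S x| =
          ∑ S ∈ levelSets l V, |∑ x ∈ H, realChar S x| := by
        symm
        refine sum_subset (fun S hS => ?_) fun S hS hS' => ?_
        · simpa using (mem_levelSets.1 hS).1
        · rw [hH.sum_eq_zero S fun h => hS' (mem_levelSets.2 ⟨by simpa using hS, h⟩), abs_zero]
      rw [h1]
      calc ∑ S ∈ levelSets l V, |∑ x ∈ H, realChar S x|
          ≤ ∑ S ∈ levelSets l V, (H.card : ℝ) := by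
            refine sum_le_sum fun S _ => (abs_sum_le_sum_abs _ _).trans ?_
            simp [abs_realChar]
        _ = H.card * (levelSets l V).card := by simp [mul_comm]
        _ ≤ H.card * N := by
            gcongr
            exact hN V (by simpa [ParityTree.depth] using hD)
  | node Q pos neg ihp ihn =>
    have hr := finrank_sup_span_singleton_le V (parityVec Q)
    rw [ParityTree.depth] at hD
    have hp := ihp _ _ (hH.filter Q 1) (by omega)
    have hn := ihn _ _ (hH.filter Q (-1)) (by omega)
    have h1 := sum_node_eq H Q pos neg fun _ => 1
    simp only [mul_one] at h1
    rw [h1, add_mul]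
    refine le_trans ?_ (add_le_add hp hn)
    rw [← sum_add_distrib]
    refine sum_le_sum fun S _ => ?_
    rw [sum_node_eq]
    exact abs_add_le _ _

end Counting

/-! ### Two-point moment inequalities -/

section TwoPoint

lemma mul_sub_pow_sub_pow_le {U W c : ℝ} (hU : 0 ≤ U) (hW : 0 ≤ W) (m : ℕ)
    (h : (U - W) ^ 2 ≤ 8 * c * (U + W)) (hc : 0 ≤ c) :
    (U - W) * (U ^ m - W ^ m) ≤ m * (16 * c) * (U ^ m + W ^ m) := by
  wlog hUW : W ≤ U generalizing U W
  · have := this hW hU (by linarith [h]) (by linarith)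
    linarith
  rcases m with _ | m
  · simp
  have h1 : U ^ (m + 1) - W ^ (m + 1) ≤ (U - W) * (m + 1 : ℕ) * U ^ m := by
    have := abs_pow_sub_pow_le U W (m + 1)
    rw [abs_of_nonneg hU, abs_of_nonneg hW, max_eq_left hUW,
      abs_of_nonneg (sub_nonneg.2 hUW)] at this
    exact (le_abs_self _).trans this
  have h2 : (U - W) ^ 2 ≤ 16 * c * U := by nlinarith
  calc (U - W) * (U ^ (m + 1) - W ^ (m + 1))
      ≤ (U - W) * ((U - W) * (m + 1 : ℕ) * U ^ m) :=
        mul_le_mul_of_nonneg_left h1 (sub_nonneg.2 hUW)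
    _ = (U - W) ^ 2 * ((m + 1 : ℕ) * U ^ m) := by ring
    _ ≤ 16 * c * U * ((m + 1 : ℕ) * U ^ m) := by gcongr
    _ = (m + 1 : ℕ) * (16 * c) * (U ^ (m + 1) + 0) := by ring
    _ ≤ (m + 1 : ℕ) * (16 * c) * (U ^ (m + 1) + W ^ (m + 1)) := by gcongr; positivity

/-- A two-point hypercontractive inequality. -/
lemma add_pow_add_sub_pow_le (Y Z : ℝ) (m : ℕ) :
    (Y + Z) ^ (2 * m) + (Y - Z) ^ (2 * m) ≤ 2 * (Y ^ 2 + 8 * m * Z ^ 2) ^ m := by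
  rw [pow_mul, pow_mul]
  suffices h : ∀ k ≤ m, ((Y + Z) ^ 2) ^ k + ((Y - Z) ^ 2) ^ k ≤
      2 * (Y ^ 2 + 8 * m * Z ^ 2) ^ k from h m le_rfl
  intro k hk
  induction k with
  | zero => norm_num
  | succ k ih =>
    have ih := ih (by omega)
    -- Here U - W = 4YZ and U + W = 2(Y² + Z²), so the hypothesis reads 16Y²Z² ≤ 16Z²(Y² + Z²).
    have h1 := mul_sub_pow_sub_pow_le (U := (Y + Z) ^ 2) (W := (Y - Z) ^ 2) (c := Z ^ 2)
      (sq_nonneg _) (sq_nonneg _) k (by nlinarith [sq_nonneg (Z ^ 2)]) (sq_nonneg _)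
    set A := ((Y + Z) ^ 2) ^ k
    set B := ((Y - Z) ^ 2) ^ k
    have hA : 0 ≤ A := by positivity
    have hB : 0 ≤ B := by positivity
    have hkm : (k : ℝ) + 1 ≤ m := by exact_mod_cast hk
    calc ((Y + Z) ^ 2) ^ (k + 1) + ((Y - Z) ^ 2) ^ (k + 1)
        = (Y ^ 2 + Z ^ 2) * (A + B) + ((Y + Z) ^ 2 - (Y - Z) ^ 2) * (A - B) / 2 := by
          simp only [A, B]; ring
      _ ≤ (Y ^ 2 + Z ^ 2) * (A + B) + k * (16 * Z ^ 2) * (A + B) / 2 := by gcongr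
      _ = (Y ^ 2 + (1 + 8 * k) * Z ^ 2) * (A + B) := by ring
      _ ≤ (Y ^ 2 + 8 * m * Z ^ 2) * (A + B) := by gcongr; linarith
      _ ≤ (Y ^ 2 + 8 * m * Z ^ 2) * (2 * (Y ^ 2 + 8 * m * Z ^ 2) ^ k) := by gcongr
      _ = _ := by ring

lemma add_pow_succ_le_weighted {a b D : ℝ} (ha : 0 ≤ a) (hb : 0 ≤ b) (hD : 0 < D) (m : ℕ) :
    (a + b) ^ (m + 1) ≤ (1 + 1 / D) ^ m * a ^ (m + 1) + (1 + D) ^ m * b ^ (m + 1) := by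
  have hx : (1 + 1 / D) * a ∈ Set.Ici (0 : ℝ) := Set.mem_Ici.2 (by positivity)
  have hy : (1 + D) * b ∈ Set.Ici (0 : ℝ) := Set.mem_Ici.2 (by positivity)
  have h1 : 0 ≤ D / (1 + D) := by positivity
  have h2 : 0 ≤ 1 / (1 + D) := by positivity
  have h3 : D / (1 + D) + 1 / (1 + D) = 1 := by field_simp; ring
  -- Convexity, with a + b written as the average of (1 + 1/D)a and (1 + D)b with weights D/(1 + D)
  -- and 1/(1 + D).
  have h := (convexOn_pow (𝕜 := ℝ) (m + 1)).2 hx hy h1 h2 h3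
  simp only [smul_eq_mul] at h
  have e1 : D / (1 + D) * ((1 + 1 / D) * a) + 1 / (1 + D) * ((1 + D) * b) = a + b := by
    field_simp
    ring
  have e2 : D / (1 + D) * ((1 + 1 / D) * a) ^ (m + 1) = (1 + 1 / D) ^ m * a ^ (m + 1) := by
    have : D / (1 + D) * (1 + 1 / D) = 1 := by field_simp; ring
    calc _ = (D / (1 + D) * (1 + 1 / D)) * ((1 + 1 / D) ^ m * a ^ (m + 1)) := by rw [mul_pow]; ring
      _ = _ := by rw [this, one_mul]
  have e3 : 1 / (1 + D) * ((1 + D) * b) ^ (m + 1) = (1 + D) ^ m * b ^ (m + 1) := by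
    have : 1 / (1 + D) * (1 + D) = 1 := by field_simp
    calc _ = (1 / (1 + D) * (1 + D)) * ((1 + D) ^ m * b ^ (m + 1)) := by rw [mul_pow]; ring
      _ = _ := by rw [this, one_mul]
  rwa [e1, e2, e3] at h

/-- The growth factor of the moment at a fixed level. -/
noncomputable def sameLevelFactor (m : ℕ) (D : ℝ) : ℝ := (1 + 1 / D) ^ m

/-- The factor with which the moment of the lower level enters. -/
noncomputable def lowerLevelFactor (m : ℕ) (D : ℝ) : ℝ := (1 + D) ^ (m - 1) * (8 * m) ^ m

lemma one_le_sameLevelFactor (m : ℕ) {D : ℝ} (hD : 0 < D) : 1 ≤ sameLevelFactor m D :=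
  one_le_pow₀ (by have : 0 < 1 / D := by positivity
                  linarith)

lemma lowerLevelFactor_nonneg (m : ℕ) {D : ℝ} (hD : 0 < D) : 0 ≤ lowerLevelFactor m D := by
  unfold lowerLevelFactor; positivity

lemma two_point_moment_le {m : ℕ} (hm : 1 ≤ m) {D : ℝ} (hD : 0 < D) (Y Z : ℝ) :
    (Y + Z) ^ (2 * m) + (Y - Z) ^ (2 * m) ≤
      2 * (sameLevelFactor m D * Y ^ (2 * m) + lowerLevelFactor m D * Z ^ (2 * m)) := by
  refine (add_pow_add_sub_pow_le Y Z m).trans (mul_le_mul_of_nonneg_left ?_ (by norm_num))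
  obtain ⟨m, rfl⟩ : ∃ k, m = k + 1 := ⟨m - 1, by omega⟩
  refine (add_pow_succ_le_weighted (sq_nonneg Y) (by positivity) hD m).trans ?_
  rw [sameLevelFactor, lowerLevelFactor, Nat.add_sub_cancel, pow_mul, pow_mul, mul_pow (8 * _),
    ← mul_assoc]
  gcongr
  · have : 0 < 1 / D := by positivity
    linarith
  · exact Nat.le_succ m

end TwoPoint

/-! ### Moments of the walk as coordinates are fixed -/

section Walk

variable {n : ℕ}

/-- The value, once the coordinates in `F` are fixed according to `x`, of the part of
`∑_{|S| = l} a_S x_S` that is to be multiplied by `x_R`. -/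
noncomputable def walkValue (a : Finset (Fin n) → ℝ) (l : ℕ) (R F : Finset (Fin n))
    (x : SignCube n) : ℝ :=
  ∑ S ∈ F.powerset, if S.card + R.card = l ∧ Disjoint S R then a (S ∪ R) * realChar S x else 0

/-- The sum of the `q`-th powers of the walk values over all `R` of size `r`. -/
noncomputable def levelMoment (a : Finset (Fin n) → ℝ) (l q r : ℕ) (F : Finset (Fin n))
    (x : SignCube n) : ℝ :=
  ∑ R ∈ powersetCard r univ, walkValue a l R F x ^ q

/-- The potential when `s` more coordinates may be fixed. -/
noncomputable def potential (a : Finset (Fin n) → ℝ) (l m : ℕ) (D : ℝ) :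
    ℕ → ℕ → Finset (Fin n) → SignCube n → ℝ
  | 0, r, F, x => levelMoment a l (2 * m) r F x
  | s + 1, r, F, x => sameLevelFactor m D * potential a l m D s r F x +
      lowerLevelFactor m D * potential a l m D s (r + 1) F x

variable {a : Finset (Fin n) → ℝ} {l m : ℕ} {D : ℝ}

lemma walkValue_congr {R F : Finset (Fin n)} {x y : SignCube n} (h : ∀ i ∈ F, x i = y i) :
    walkValue a l R F x = walkValue a l R F y := by
  refine sum_congr rfl fun S hS => ?_
  rw [realChar_congr fun i hi => h i (mem_powerset.1 hS hi)]

lemma potential_congr {F : Finset (Fin n)} {x y : SignCube n} (h : ∀ i ∈ F, x i = y i)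
    (s r : ℕ) : potential a l m D s r F x = potential a l m D s r F y := by
  induction s generalizing r with
  | zero => simp only [potential, levelMoment, walkValue_congr h]
  | succ s ih => rw [potential, potential, ih, ih]

lemma walkValue_insert_of_mem {i : Fin n} {R F : Finset (Fin n)} (hiF : i ∉ F) (hiR : i ∈ R)
    (x : SignCube n) : walkValue a l R (insert i F) x = walkValue a l R F x := by
  unfold walkValue
  rw [sum_powerset_insert hiF, add_eq_left]
  refine sum_eq_zero fun S _ => if_neg fun h => ?_
  exact disjoint_left.1 h.2 (mem_insert_self i S) hiR

lemma walkValue_insert_of_notMem {i : Fin n} {R F : Finset (Fin n)} (hiF : i ∉ F) (hiR : i ∉ R)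
    (x : SignCube n) : walkValue a l R (insert i F) x =
      walkValue a l R F x + ((x i : ℤ) : ℝ) * walkValue a l (insert i R) F x := by
  unfold walkValue
  rw [sum_powerset_insert hiF, mul_sum]
  congr 1
  refine sum_congr rfl fun S hS => ?_
  have hiS : i ∉ S := fun h => hiF (mem_powerset.1 hS h)
  have e1 : insert i S ∪ R = S ∪ insert i R := by ext; simp
  have e2 : (insert i S).card + R.card = l ∧ Disjoint (insert i S) R ↔
      S.card + (insert i R).card = l ∧ Disjoint S (insert i R) := by
    rw [card_insert_of_notMem hiS, card_insert_of_notMem hiR, disjoint_insert_left,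
      disjoint_insert_right]
    simp only [hiS, hiR, not_false_eq_true, true_and]
    rw [add_right_comm, add_assoc]
  simp only [e1, e2, realChar_insert hiS]
  split_ifs <;> ring

lemma walkValue_flipAt {i : Fin n} {R F : Finset (Fin n)} (hiF : i ∉ F) (x : SignCube n) :
    walkValue a l R F (flipAt i x) = walkValue a l R F x :=
  walkValue_congr fun j hj => by
    rw [flipAt, Function.update_of_ne]; rintro rfl; exact hiF hj

lemma levelMoment_nonneg (r : ℕ) (F : Finset (Fin n)) (x : SignCube n) :
    0 ≤ levelMoment a l (2 * m) r F x :=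
  sum_nonneg fun R _ => by rw [pow_mul]; positivity

/-- The two values of x_i turn Y = W_R into Y ± Z with Z = W_{R ∪ i}, and the two-point inequality
applies for each R avoiding i. The map R ↦ R ∪ i is injective on such R, so the Z-terms are part of
the moment at level r + 1. -/
lemma levelMoment_insert_le (hm : 1 ≤ m) (hD : 0 < D) {i : Fin n} {F : Finset (Fin n)}
    (hiF : i ∉ F) (r : ℕ) (x : SignCube n) :
    levelMoment a l (2 * m) r (insert i F) x +
        levelMoment a l (2 * m) r (insert i F) (flipAt i x) ≤
      2 * (sameLevelFactor m D * levelMoment a l (2 * m) r F x +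
        lowerLevelFactor m D * levelMoment a l (2 * m) (r + 1) F x) := by
  have hpt : ∀ R ∈ powersetCard r univ, walkValue a l R (insert i F) x ^ (2 * m) +
      walkValue a l R (insert i F) (flipAt i x) ^ (2 * m) ≤
      2 * (sameLevelFactor m D * walkValue a l R F x ^ (2 * m) + lowerLevelFactor m D *
        (if i ∈ R then 0 else walkValue a l (insert i R) F x ^ (2 * m))) := by
    intro R _
    split_ifs with hiR
    · rw [walkValue_insert_of_mem hiF hiR, walkValue_insert_of_mem hiF hiR, walkValue_flipAt hiF]
      have h1 := one_le_sameLevelFactor m hD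
      have h2 : 0 ≤ walkValue a l R F x ^ (2 * m) := by rw [pow_mul]; positivity
      nlinarith
    · rw [walkValue_insert_of_notMem hiF hiR, walkValue_insert_of_notMem hiF hiR,
        walkValue_flipAt hiF, walkValue_flipAt hiF]
      have h := two_point_moment_le hm hD (walkValue a l R F x)
        (walkValue a l (insert i R) F x)
      have hx : flipAt i x i = -x i := by simp [flipAt]
      rw [hx]
      rcases Int.units_eq_one_or (x i) with h1 | h1 <;> rw [h1] <;> push_cast <;>
        simp only [one_mul, neg_mul, ← sub_eq_add_neg] <;> linarith
  have hlow : ∑ R ∈ powersetCard r univ,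
      (if i ∈ R then 0 else walkValue a l (insert i R) F x ^ (2 * m)) ≤
      levelMoment a l (2 * m) (r + 1) F x := by
    have h0 := sum_filter (p := fun R : Finset (Fin n) => i ∉ R) (s := powersetCard r univ)
      fun R => walkValue a l (insert i R) F x ^ (2 * m)
    simp only [ite_not] at h0
    rw [← h0]
    have hinj : Set.InjOn (insert i) ((powersetCard r univ).filter (fun R => i ∉ R) :
        Set (Finset (Fin n))) := by
      intro R hR R' hR' h
      simp only [coe_filter, Set.mem_ofPred_eq] at hR hR'
      rw [← erase_insert hR.2, h, erase_insert hR'.2]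
    rw [← sum_image (f := fun R => walkValue a l R F x ^ (2 * m)) hinj]
    refine sum_le_sum_of_subset_of_nonneg ?_ fun R _ _ => by rw [pow_mul]; positivity
    intro R hR
    obtain ⟨R', hR', rfl⟩ := mem_image.1 hR
    simp only [mem_filter, mem_powersetCard, subset_univ, true_and] at hR' ⊢
    rw [card_insert_of_notMem hR'.2, hR'.1]
  unfold levelMoment at hlow ⊢
  rw [← sum_add_distrib]
  refine (sum_le_sum hpt).trans ?_
  rw [← mul_sum, sum_add_distrib, ← mul_sum, ← mul_sum]
  have := mul_le_mul_of_nonneg_left hlow (lowerLevelFactor_nonneg m hD)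
  linarith

lemma potential_insert_le (hm : 1 ≤ m) (hD : 0 < D) {i : Fin n} {F : Finset (Fin n)}
    (hiF : i ∉ F) (s r : ℕ) (x : SignCube n) :
    potential a l m D s r (insert i F) x + potential a l m D s r (insert i F) (flipAt i x) ≤
      2 * potential a l m D (s + 1) r F x := by
  induction s generalizing r with
  | zero => exact levelMoment_insert_le hm hD hiF r x
  | succ s ih =>
    rw [potential, potential, potential]
    have h1 := mul_le_mul_of_nonneg_left (ih r)
      (zero_le_one.trans (one_le_sameLevelFactor m hD))
    have h2 := mul_le_mul_of_nonneg_left (ih (r + 1)) (lowerLevelFactor_nonneg m hD)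
    linarith

lemma potential_nonneg (hD : 0 < D) (s r : ℕ) (F : Finset (Fin n)) (x : SignCube n) :
    0 ≤ potential a l m D s r F x := by
  induction s generalizing r with
  | zero => exact levelMoment_nonneg r F x
  | succ s ih =>
    exact add_nonneg (mul_nonneg (zero_le_one.trans (one_le_sameLevelFactor m hD)) (ih r))
      (mul_nonneg (lowerLevelFactor_nonneg m hD) (ih (r + 1)))

lemma levelMoment_le_potential (hD : 0 < D) (s r : ℕ) (F : Finset (Fin n)) (x : SignCube n) :
    levelMoment a l (2 * m) r F x ≤ potential a l m D s r F x := by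
  induction s with
  | zero => exact le_rfl
  | succ s ih =>
    rw [potential]
    have h1 := one_le_sameLevelFactor m hD
    have h2 := mul_nonneg (lowerLevelFactor_nonneg m hD)
      (potential_nonneg (a := a) (l := l) (m := m) hD s (r + 1) F x)
    have h3 := potential_nonneg (a := a) (l := l) (m := m) hD s r F x
    nlinarith

lemma walkValue_empty_pow_le_potential (hD : 0 < D) (s : ℕ) (F : Finset (Fin n))
    (x : SignCube n) :
    walkValue a l ∅ F x ^ (2 * m) ≤ potential a l m D s 0 F x := by
  refine le_trans (le_of_eq ?_) (levelMoment_le_potential hD s 0 F x)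
  simp [levelMoment]

lemma levelMoment_empty_of_lt (hm : 1 ≤ m) {r : ℕ} (hr : r < l) (x : SignCube n) :
    levelMoment a l (2 * m) r ∅ x = 0 := by
  refine sum_eq_zero fun R hR => ?_
  rw [mem_powersetCard] at hR
  rw [walkValue, powerset_empty, sum_singleton, if_neg, zero_pow (by omega)]
  rw [card_empty]; omega

lemma levelMoment_empty_le (ha : ∀ S, |a S| ≤ 1) (x : SignCube n) :
    levelMoment a l (2 * m) l ∅ x ≤ (n : ℝ) ^ l := by
  calc levelMoment a l (2 * m) l ∅ x ≤ ∑ R ∈ powersetCard l (univ : Finset (Fin n)), (1 : ℝ) := by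
        refine sum_le_sum fun R hR => ?_
        rw [mem_powersetCard] at hR
        rw [walkValue, powerset_empty, sum_singleton, if_pos (by simp [hR.2]), realChar_empty,
          mul_one, pow_mul]
        exact pow_le_one₀ (sq_nonneg _) ((sq_le_one_iff_abs_le_one _).2 (ha _))
    _ = (n.choose l : ℝ) := by simp
    _ ≤ (n : ℝ) ^ l := by exact_mod_cast Nat.choose_le_pow n l

lemma levelMoment_of_gt (hm : 1 ≤ m) {r : ℕ} (hr : l < r) (F : Finset (Fin n))
    (x : SignCube n) : levelMoment a l (2 * m) r F x = 0 := by
  refine sum_eq_zero fun R hR => ?_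
  rw [mem_powersetCard] at hR
  rw [walkValue, sum_eq_zero, zero_pow (by omega)]
  exact fun S _ => if_neg (by omega)

lemma potential_of_gt (hm : 1 ≤ m) (s : ℕ) {r : ℕ} (hr : l < r) (F : Finset (Fin n))
    (x : SignCube n) : potential a l m D s r F x = 0 := by
  induction s generalizing r with
  | zero => exact levelMoment_of_gt hm hr F x
  | succ s ih => rw [potential, ih hr, ih (by omega), mul_zero, mul_zero, add_zero]

/-- With no coordinate fixed only level l has a nonzero moment, so exactly j of the s steps must
raise the level; there are at most s^j ways to place them. -/
lemma potential_empty_le (hm : 1 ≤ m) (hD : 0 < D) (ha : ∀ S, |a S| ≤ 1) (s j r : ℕ)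
    (hj : r + j = l) (x : SignCube n) :
    potential a l m D s r ∅ x ≤
      sameLevelFactor m D ^ s * (s * lowerLevelFactor m D) ^ j * (n : ℝ) ^ l := by
  have hα := one_le_sameLevelFactor m hD
  have hα0 : 0 ≤ sameLevelFactor m D := zero_le_one.trans hα
  have hβ := lowerLevelFactor_nonneg m hD
  induction s generalizing j r with
  | zero =>
    rcases j with _ | j
    · obtain rfl : r = l := by omega
      simpa [potential] using levelMoment_empty_le ha x
    · rw [potential, levelMoment_empty_of_lt hm (by omega)]; simp
  | succ s ih =>
    rw [potential]
    rcases j with _ | j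
    · rw [potential_of_gt hm s (show l < r + 1 by omega), mul_zero, add_zero]
      calc _ ≤ _ := mul_le_mul_of_nonneg_left (ih 0 r hj) hα0
        _ = _ := by ring
    · have h1 := mul_le_mul_of_nonneg_left (ih (j + 1) r hj) hα0
      have h2 := mul_le_mul_of_nonneg_left (ih j (r + 1) (by omega)) hβ
      refine (add_le_add h1 h2).trans ?_
      set α := sameLevelFactor m D
      set β := lowerLevelFactor m D
      have hs : (s : ℝ) ^ (j + 1) + (s : ℝ) ^ j ≤ ((s + 1 : ℕ) : ℝ) ^ (j + 1) := by
        calc (s : ℝ) ^ (j + 1) + (s : ℝ) ^ j = (s + 1) * (s : ℝ) ^ j := by ring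
          _ ≤ (s + 1) * ((s : ℝ) + 1) ^ j := by gcongr; linarith
          _ = _ := by push_cast; ring
      have hαs : α ^ s ≤ α ^ (s + 1) := pow_le_pow_right₀ hα (Nat.le_succ s)
      calc α * (α ^ s * (s * β) ^ (j + 1) * (n : ℝ) ^ l) + β * (α ^ s * (s * β) ^ j * (n : ℝ) ^ l)
          = (α ^ (s + 1) * (s : ℝ) ^ (j + 1) + α ^ s * (s : ℝ) ^ j) *
              (β ^ (j + 1) * (n : ℝ) ^ l) := by ring
        _ ≤ (α ^ (s + 1) * (s : ℝ) ^ (j + 1) + α ^ (s + 1) * (s : ℝ) ^ j) *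
              (β ^ (j + 1) * (n : ℝ) ^ l) := by gcongr
        _ = α ^ (s + 1) * ((s : ℝ) ^ (j + 1) + (s : ℝ) ^ j) * (β ^ (j + 1) * (n : ℝ) ^ l) := by
          ring
        _ ≤ α ^ (s + 1) * ((s + 1 : ℕ) : ℝ) ^ (j + 1) * (β ^ (j + 1) * (n : ℝ) ^ l) := by gcongr
        _ = _ := by rw [mul_pow]; ring

end Walk

/-! ### Fourier degree of the potential -/

section LowDegree

variable {n : ℕ}

/-- The functions on the cube of Fourier degree at most `k`. -/
def lowDegree (n k : ℕ) : Submodule ℝ (SignCube n → ℝ) :=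
  Submodule.span ℝ (realChar '' {S : Finset (Fin n) | S.card ≤ k})

lemma realChar_mem_lowDegree {k : ℕ} {S : Finset (Fin n)} (hS : S.card ≤ k) :
    realChar S ∈ lowDegree n k :=
  Submodule.subset_span ⟨S, hS, rfl⟩

lemma mul_mem_lowDegree {j k : ℕ} {g h : SignCube n → ℝ} (hg : g ∈ lowDegree n j)
    (hh : h ∈ lowDegree n k) : g * h ∈ lowDegree n (j + k) := by
  have := Submodule.mul_mem_mul hg hh
  rw [lowDegree, lowDegree, Submodule.span_mul_span] at this
  refine Submodule.span_le.2 ?_ this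
  rintro _ ⟨_, ⟨S, hS, rfl⟩, _, ⟨T, hT, rfl⟩, rfl⟩
  have e : realChar S * realChar T = realChar (symmDiff S T) := by
    funext x; rw [realChar_symmDiff]; rfl
  change realChar S * realChar T ∈ lowDegree n (j + k)
  rw [e]
  refine realChar_mem_lowDegree ?_
  have h1 : symmDiff S T ⊆ S ∪ T := symmDiff_le_sup
  exact (card_le_card h1).trans ((card_union_le S T).trans (add_le_add hS hT))

lemma pow_mem_lowDegree {j : ℕ} {g : SignCube n → ℝ} (hg : g ∈ lowDegree n j) (q : ℕ) :
    g ^ q ∈ lowDegree n (q * j) := by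
  induction q with
  | zero =>
    have : g ^ 0 = realChar ∅ := by funext x; simp [realChar_empty]
    rw [this]
    exact realChar_mem_lowDegree (by simp)
  | succ q ih => rw [pow_succ, Nat.succ_mul]; exact mul_mem_lowDegree ih hg

variable {a : Finset (Fin n) → ℝ} {l m : ℕ} {D : ℝ}

lemma walkValue_mem_lowDegree (R F : Finset (Fin n)) :
    walkValue a l R F ∈ lowDegree n l := by
  have e : walkValue a l R F = ∑ S ∈ F.powerset,
      if S.card + R.card = l ∧ Disjoint S R then a (S ∪ R) • realChar S else 0 := by
    funext x
    rw [walkValue, Finset.sum_apply]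
    refine sum_congr rfl fun S _ => ?_
    split_ifs <;> simp
  rw [e]
  refine Submodule.sum_mem _ fun S _ => ?_
  split_ifs with h
  · exact Submodule.smul_mem _ _ (realChar_mem_lowDegree (by omega))
  · exact zero_mem _

lemma potential_mem_lowDegree (s r : ℕ) (F : Finset (Fin n)) :
    potential a l m D s r F ∈ lowDegree n (2 * m * l) := by
  induction s generalizing r with
  | zero =>
    have e : potential a l m D 0 r F = ∑ R ∈ powersetCard r univ, walkValue a l R F ^ (2 * m) := by
      funext x
      simp [potential, levelMoment]
    rw [e]
    exact Submodule.sum_mem _ fun R _ => pow_mem_lowDegree (walkValue_mem_lowDegree R F) _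
  | succ s ih =>
    have e : potential a l m D (s + 1) r F = sameLevelFactor m D • potential a l m D s r F +
        lowerLevelFactor m D • potential a l m D s (r + 1) F := by
      funext x
      simp [potential]
    rw [e]
    exact add_mem (Submodule.smul_mem _ _ (ih r)) (Submodule.smul_mem _ _ (ih (r + 1)))

end LowDegree

/-! ### Clean subspaces -/

section Clean

variable {n : ℕ}

/-- The vectors of weight at most `k` in `V` are supported on `F`, and `V` contains the unit
vectors of `F`. -/
structure IsClean (k : ℕ) (V : Submodule (ZMod 2) (Fin n → ZMod 2)) (F : Finset (Fin n)) :
    Prop where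
  coordSpan_le : coordSpan F ≤ V
  subset : ∀ S, S.card ≤ k → parityVec S ∈ V → S ⊆ F

lemma isClean_bot (k : ℕ) : IsClean k (⊥ : Submodule (ZMod 2) (Fin n → ZMod 2)) ∅ := by
  refine ⟨by simp [coordSpan], fun S _ hS => ?_⟩
  rw [Submodule.mem_bot, ← parityVec_empty] at hS
  rw [parityVec_injective hS]

/-- Since R already lies in the space, its last new unit vector is R minus the other ones and comes
for free. -/
lemma finrank_sup_coordSpan_union_lt {V : Submodule (ZMod 2) (Fin n → ZMod 2)}
    {F R : Finset (Fin n)} (hR : parityVec R ∈ V ⊔ coordSpan F) (hRF : ¬ R ⊆ F) :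
    Module.finrank (ZMod 2) ↥(V ⊔ coordSpan (F ∪ R)) + 1 ≤
      Module.finrank (ZMod 2) ↥(V ⊔ coordSpan F) + (R \ F).card := by
  obtain ⟨i, hiR, hiF⟩ := not_subset.1 hRF
  have hi : i ∈ R \ F := mem_sdiff.2 ⟨hiR, hiF⟩
  have hmem : ∀ j ∈ (F ∪ R).erase i,
      parityVec {j} ∈ V ⊔ coordSpan F ⊔ coordSpan ((R \ F).erase i) := by
    intro j hj
    rw [mem_erase, mem_union] at hj
    by_cases hjF : j ∈ F
    · exact Submodule.mem_sup_left (Submodule.mem_sup_right (parityVec_singleton_mem_coordSpan hjF))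
    · refine Submodule.mem_sup_right (parityVec_singleton_mem_coordSpan ?_)
      rw [mem_erase, mem_sdiff]
      exact ⟨hj.1, hj.2.resolve_left hjF, hjF⟩
  have hle : V ⊔ coordSpan (F ∪ R) ≤ V ⊔ coordSpan F ⊔ coordSpan ((R \ F).erase i) := by
    refine sup_le (le_sup_left.trans le_sup_left) (coordSpan_le.2 fun j hj => ?_)
    by_cases hji : j = i
    · subst hji
      have e : parityVec {j} = parityVec R - ∑ t ∈ R.erase j, parityVec {t} := by
        rw [parityVec_eq_sum R, ← add_sum_erase R _ hiR, add_sub_cancel_right]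
      rw [e]
      refine sub_mem (Submodule.mem_sup_left hR) (Submodule.sum_mem _ fun t ht => hmem t ?_)
      rw [mem_erase] at ht ⊢
      exact ⟨ht.1, mem_union_right _ ht.2⟩
    · exact hmem j (mem_erase.2 ⟨hji, hj⟩)
  have h1 := (Submodule.finrank_mono hle).trans (finrank_sup_coordSpan_le _ _)
  have h2 := card_erase_add_one hi
  omega

/-- Any subspace becomes clean when the coordinates of its short vectors are fixed one vector
after the other; each of these vectors reduces the rank in excess of the fixed coordinates. -/
lemma exists_isClean_sup (k : ℕ) {V : Submodule (ZMod 2) (Fin n → ZMod 2)} {F : Finset (Fin n)}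
    (hF : coordSpan F ≤ V) :
    ∃ F', F ⊆ F' ∧ IsClean k (V ⊔ coordSpan F') F' ∧
      (F' \ F).card + k * Module.finrank (ZMod 2) ↥(V ⊔ coordSpan F') + k * F.card ≤
        k * Module.finrank (ZMod 2) V + k * F'.card := by
  classical
  -- The condition says that |F' \ F| is at most k times the drop of rank minus number of fixed
  -- coordinates. A largest such F' is clean: a short vector R not inside it could be added, with at
  -- most k new coordinates.
  set P : Finset (Finset (Fin n)) := univ.filter fun F' => F ⊆ F' ∧
    (F' \ F).card + k * Module.finrank (ZMod 2) ↥(V ⊔ coordSpan F') + k * F.card ≤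
        k * Module.finrank (ZMod 2) V + k * F'.card with hP
  have hFP : F ∈ P := by
    rw [hP, mem_filter, sup_eq_left.2 hF]
    simp
  obtain ⟨F', hF'P, hmax⟩ := exists_max_image P card ⟨F, hFP⟩
  rw [hP, mem_filter] at hF'P
  obtain ⟨-, hFF', hcard⟩ := hF'P
  refine ⟨F', hFF', ⟨le_sup_right, fun R hRk hR => ?_⟩, hcard⟩
  by_contra hRF
  have hlt := finrank_sup_coordSpan_union_lt hR hRF
  have hunion : (F' ∪ R).card = F'.card + (R \ F').card := by
    rw [← union_sdiff_self_eq_union, card_union_of_disjoint disjoint_sdiff]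
  have hpos : 0 < (R \ F').card := card_pos.2 (sdiff_nonempty.2 hRF)
  have hmem : F' ∪ R ∈ P := by
    rw [hP, mem_filter]
    refine ⟨mem_univ _, hFF'.trans subset_union_left, ?_⟩
    have h1 := card_sdiff_add_card_eq_card hFF'
    have h2 := card_sdiff_add_card_eq_card (hFF'.trans (subset_union_left (s₂ := R)))
    have h3 : (R \ F').card ≤ k := (card_le_card sdiff_subset).trans hRk
    have h4 := Nat.mul_le_mul_left k hlt
    rw [hunion] at h2 ⊢
    rw [mul_add, mul_add] at h4
    rw [mul_add]
    omega
  have := hmax _ hmem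
  omega

end Clean

/-! ### Averaging over newly fixed coordinates -/

section Averaging

variable {n : ℕ}

/-- The point that agrees with `x` on `F` and with `y` elsewhere. -/
def mixAt (F : Finset (Fin n)) (x y : SignCube n) : SignCube n :=
  fun i => if i ∈ F then x i else y i

lemma realChar_mixAt (F S : Finset (Fin n)) (x y : SignCube n) :
    realChar S (mixAt F x y) = realChar (S ∩ F) x * realChar (S \ F) y := by
  have e : S = symmDiff (S ∩ F) (S \ F) := by
    ext i; simp only [mem_symmDiff, mem_inter, mem_sdiff]; tauto
  conv_lhs => rw [e, realChar_symmDiff]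
  congr 1
  · exact realChar_congr fun i hi => if_pos (mem_inter.1 hi).2
  · exact realChar_congr fun i hi => if_neg (mem_sdiff.1 hi).2

lemma mixAt_flipAt {F : Finset (Fin n)} {i : Fin n} (hi : i ∉ F) (x y : SignCube n) :
    mixAt F x (flipAt i y) = flipAt i (mixAt F x y) := by
  funext j
  by_cases hj : j = i
  · subst hj; simp [mixAt, flipAt, hi]
  · simp [mixAt, flipAt, Function.update_of_ne hj]

/-- On a clean affine subspace, functions of low degree average as if the coordinates that are not
fixed were independent and uniform. -/
lemma IsClean.sum_eq_sum_mixAt {k : ℕ} {V : Submodule (ZMod 2) (Fin n → ZMod 2)}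
    {F : Finset (Fin n)} (hV : IsClean k V F) {H : Finset (SignCube n)} (hH : IsAffine H V)
    {g : SignCube n → ℝ} (hg : g ∈ lowDegree n k) :
    2 ^ n * ∑ x ∈ H, g x = ∑ x ∈ H, ∑ y, g (mixAt F x y) := by
  induction hg using Submodule.span_induction with
  | mem g hg =>
    obtain ⟨S, hS, rfl⟩ := hg
    simp only [realChar_mixAt, ← mul_sum]
    by_cases hSF : S ⊆ F
    · rw [inter_eq_left.2 hSF, sdiff_eq_empty_iff_subset.2 hSF]
      simp [realChar_empty, mul_sum, mul_comm]
    -- Cleanness keeps S out of `V`, so the left side vanishes; the right side vanishes because S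
    -- has a free coordinate outside F.
    · rw [hH.sum_eq_zero S fun h => hSF (hV.subset S hS h),
        sum_realChar_eq_zero (sdiff_nonempty.2 hSF)]
      simp
  | zero => simp
  | add g h _ _ ihg ihh => simp only [Pi.add_apply, sum_add_distrib, mul_add, ihg, ihh]
  | smul c g _ ih =>
    simp only [Pi.smul_apply, smul_eq_mul, ← mul_sum]
    rw [mul_left_comm, ih]

variable {a : Finset (Fin n) → ℝ} {l m : ℕ} {D : ℝ}

/-- The coordinates of J are peeled off one at a time; averaging each over its two signs costs one
unit of `s`. -/
lemma sum_potential_mixAt_le (hm : 1 ≤ m) (hD : 0 < D) {F : Finset (Fin n)} (J : Finset (Fin n))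
    (hJ : Disjoint F J) (s r : ℕ) (x : SignCube n) :
    ∑ y, potential a l m D s r (F ∪ J) (mixAt F x y) ≤
      2 ^ n * potential a l m D (s + J.card) r F x := by
  induction J using Finset.induction_on generalizing s with
  | empty =>
    have h : ∀ y, potential a l m D s r F (mixAt F x y) = potential a l m D s r F x :=
      fun y => potential_congr (fun i hi => if_pos hi) s r
    simp [h]
  | insert i J hiJ ih =>
    rw [disjoint_insert_right] at hJ
    have hi : i ∉ F ∪ J := by simp [hJ.1, hiJ]
    have h1 := ih hJ.2 (s + 1)
    have h2 := sum_flipAt i fun y => potential a l m D s r (insert i (F ∪ J)) (mixAt F x y)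
    simp only [mixAt_flipAt hJ.1] at h2
    have h3 := sum_le_sum fun y (_ : y ∈ univ) =>
      potential_insert_le (a := a) (l := l) hm hD hi s r (mixAt F x y)
    rw [sum_add_distrib, ← mul_sum, h2] at h3
    rw [union_insert, card_insert_of_notMem hiJ, add_comm J.card, ← add_assoc]
    linarith

/-- The potential has degree at most 2ml, exactly the range in which a clean space is
indistinguishable from free coordinates. -/
lemma IsClean.sum_potential_le (hm : 1 ≤ m) (hD : 0 < D)
    {V : Submodule (ZMod 2) (Fin n → ZMod 2)} {F F' : Finset (Fin n)}
    (hV : IsClean (2 * m * l) V F) {H : Finset (SignCube n)} (hH : IsAffine H V) (hF : F ⊆ F')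
    (s r : ℕ) :
    ∑ x ∈ H, potential a l m D s r F' x ≤
      ∑ x ∈ H, potential a l m D (s + (F' \ F).card) r F x := by
  have h1 := hV.sum_eq_sum_mixAt hH
    (potential_mem_lowDegree (a := a) (l := l) (m := m) (D := D) s r F')
  have h2 := sum_le_sum fun x (_ : x ∈ H) =>
    sum_potential_mixAt_le (a := a) (l := l) hm hD (F' \ F) disjoint_sdiff s r x
  rw [union_sdiff_of_subset hF, ← h1, ← mul_sum] at h2
  exact le_of_mul_le_mul_left h2 (by positivity)

end Averaging

/-! ### Induction on the tree -/

section TreeInduction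

variable {n : ℕ} {a : Finset (Fin n) → ℝ} {l m : ℕ} {D : ℝ}

/-- The budget `s` covers 2ml coordinates for each remaining query and for each unit of the excess
rank V - |F|. The function g is assembled leaf by leaf from walk values. -/
theorem exists_sum_eval_eq_and_sum_pow_le (hm : 1 ≤ m) (hD : 0 < D) (T : ParityTree n)
    (H : Finset (SignCube n)) (V : Submodule (ZMod 2) (Fin n → ZMod 2)) (F : Finset (Fin n))
    (hH : IsAffine H V) (hV : IsClean (2 * m * l) V F) (s : ℕ)
    (hs : 2 * m * l * (T.depth + Module.finrank (ZMod 2) V) ≤ s + 2 * m * l * F.card) :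
    ∃ g : SignCube n → ℝ,
      ∑ x ∈ H, T.eval x * ∑ S ∈ powersetCard l univ, a S * realChar S x =
        ∑ x ∈ H, T.eval x * g x ∧
      ∑ x ∈ H, g x ^ (2 * m) ≤ ∑ x ∈ H, potential a l m D s 0 F x := by
  induction T generalizing H V F s with
  | leaf b =>
    refine ⟨walkValue a l ∅ F, ?_,
      sum_le_sum fun x _ => walkValue_empty_pow_le_potential hD s F x⟩
    have he : ∀ x, (ParityTree.leaf b : ParityTree n).eval x = if b = true then 1 else 0 :=
      fun _ => rfl
    simp only [he]
    rw [← mul_sum, ← mul_sum]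
    congr 1
    have hlm : l ≤ 2 * m * l := Nat.le_mul_of_pos_left l (by omega)
    have h1 : ∀ x, walkValue a l ∅ F x =
        ∑ S ∈ powersetCard l univ, if S ⊆ F then a S * realChar S x else 0 := by
      intro x
      rw [walkValue, ← sum_filter, ← sum_filter]
      refine sum_congr ?_ fun S _ => by rw [union_empty]
      ext S
      simp [and_comm]
    simp only [h1]
    rw [sum_comm, sum_comm (s := H)]
    refine sum_congr rfl fun S hS => ?_
    split_ifs with hSF
    · rfl
    -- As l ≤ 2ml, cleanness makes every x_S with S not inside F balanced on the leaf.
    · rw [← mul_sum, hH.sum_eq_zero S fun h => hSF (hV.subset S ?_ h), mul_zero, sum_const_zero]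
      rw [(mem_powersetCard.1 hS).2]; exact hlm
  | node Q pos neg ihp ihn =>
    classical
    set k := 2 * m * l
    have hV1 : coordSpan F ≤ V ⊔ Submodule.span (ZMod 2) {parityVec Q} :=
      hV.coordSpan_le.trans le_sup_left
    have hr1 := finrank_sup_span_singleton_le V (parityVec Q)
    -- F' depends on Q but not on its answer. The new coordinates can therefore be averaged over all
    -- of H, where `V` is still clean, although the subtrees are treated separately on each cell of
    -- `key`.
    obtain ⟨F', hFF', hclean, hcard⟩ := exists_isClean_sup k hV1
    have hr2 : F'.card ≤ Module.finrank (ZMod 2)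
        ↥(V ⊔ Submodule.span (ZMod 2) {parityVec Q} ⊔ coordSpan F') := by
      rw [← finrank_coordSpan F']
      exact Submodule.finrank_mono le_sup_right
    rw [ParityTree.depth] at hs
    have h1 := Nat.mul_le_mul_left k hr1
    have h2 := Nat.mul_le_mul_left k hr2
    simp only [mul_add, mul_one] at hs h1
    obtain ⟨s', rfl⟩ : ∃ s', s = s' + (F' \ F).card := ⟨s - (F' \ F).card, by omega⟩
    have hmax1 := Nat.mul_le_mul_left k (le_max_left pos.depth neg.depth)
    have hmax2 := Nat.mul_le_mul_left k (le_max_right pos.depth neg.depth)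
    let key : SignCube n → ℤˣ × SignCube n :=
      fun x => (parityChar Q x, fun i => if i ∈ F' then x i else 1)
    have haff : ∀ c : ℤˣ × SignCube n, IsAffine (H.filter fun x => key x = c)
        (V ⊔ Submodule.span (ZMod 2) {parityVec Q} ⊔ coordSpan F') := by
      intro c
      rcases (H.filter fun x => key x = c).eq_empty_or_nonempty with h | ⟨x₀, hx₀⟩
      · rw [h]; exact isAffine_empty _
      · have hc := (mem_filter.1 hx₀).2
        convert (hH.filter Q c.1).filter_coord F' x₀ using 1
        ext x
        simp only [mem_filter, ← hc, key, Prod.mk.injEq, and_assoc]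
        refine and_congr_right fun _ => and_congr_right fun _ => ?_
        constructor
        · intro h i hi
          simpa [hi] using congrFun h i
        · intro h
          funext i
          by_cases hi : i ∈ F' <;> simp [hi, h]
    have hsub : ∀ c : ℤˣ × SignCube n, ∃ g : SignCube n → ℝ,
        ∑ x ∈ H.filter (fun x => key x = c), (ParityTree.node Q pos neg).eval x *
            ∑ S ∈ powersetCard l univ, a S * realChar S x =
          ∑ x ∈ H.filter (fun x => key x = c), (ParityTree.node Q pos neg).eval x * g x ∧
        ∑ x ∈ H.filter (fun x => key x = c), g x ^ (2 * m) ≤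
          ∑ x ∈ H.filter (fun x => key x = c), potential a l m D s' 0 F' x := by
      intro c
      have hkey : ∀ x ∈ H.filter (fun x => key x = c), parityChar Q x = c.1 := by
        intro x hx
        rw [← (mem_filter.1 hx).2]
      by_cases hb : c.1 = 1
      · obtain ⟨g, hg1, hg2⟩ := ihp _ _ _ (haff c) hclean s' (by rw [mul_add]; omega)
        refine ⟨g, ?_, hg2⟩
        convert hg1 using 1 <;> refine sum_congr rfl fun x hx => ?_ <;>
          rw [ParityTree.eval_node, if_pos (by rw [hkey x hx, hb])]
      · obtain ⟨g, hg1, hg2⟩ := ihn _ _ _ (haff c) hclean s' (by rw [mul_add]; omega)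
        refine ⟨g, ?_, hg2⟩
        convert hg1 using 1 <;> refine sum_congr rfl fun x hx => ?_ <;>
          rw [ParityTree.eval_node, if_neg (by rw [hkey x hx]; exact hb)]
    choose g hg1 hg2 using hsub
    refine ⟨fun x => g (key x) x, ?_, ?_⟩
    · rw [← sum_fiberwise H key, ← sum_fiberwise H key]
      refine sum_congr rfl fun c _ => (hg1 c).trans (sum_congr rfl fun x hx => ?_)
      obtain rfl := (mem_filter.1 hx).2
      rfl
    · refine le_trans ?_ (hV.sum_potential_le hm hD hH hFF' s' 0)
      rw [← sum_fiberwise H key, ← sum_fiberwise H key]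
      refine sum_le_sum fun c _ => le_trans (le_of_eq ?_) (hg2 c)
      refine sum_congr rfl fun x hx => ?_
      obtain rfl := (mem_filter.1 hx).2
      rfl

end TreeInduction

/-! ### Bounds on the level mass -/

section LevelMass

variable {n : ℕ}

lemma levelMass_eq (l : ℕ) (f : SignCube n → ℝ) :
    levelMass l f = (∑ S ∈ powersetCard l univ, |∑ x, f x * realChar S x|) / 2 ^ n := by
  rw [levelMass, sum_div]
  refine sum_congr rfl fun S _ => ?_
  rw [fourierCoeffCube, abs_div, abs_of_pos (by positivity : (0 : ℝ) < 2 ^ n)]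
  rfl

lemma sum_eval_mul (T : ParityTree n) (g : SignCube n → ℝ) :
    ∑ x, T.eval x * g x = ∑ x ∈ univ.filter (fun x => T.output x = true), g x := by
  rw [sum_filter]
  refine sum_congr rfl fun x _ => ?_
  unfold ParityTree.eval
  split_ifs <;> simp

lemma sum_eval (T : ParityTree n) : (∑ x, T.eval x) / 2 ^ n = T.acceptProb := by
  have h := sum_eval_mul T fun _ => 1
  simp only [mul_one, sum_const, nsmul_eq_mul] at h
  rw [h]; rfl

lemma levelMass_eval_le_of_card_levelSets_le {l N : ℕ} (T : ParityTree n)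
    (hN : ∀ V : Submodule (ZMod 2) (Fin n → ZMod 2), Module.finrank (ZMod 2) V ≤ T.depth →
      (levelSets l V).card ≤ N) :
    levelMass l T.eval ≤ T.acceptProb * N := by
  have h := sum_abs_eval_le_of_card_levelSets_le hN T univ ⊥ isAffine_univ (by simp)
  rw [levelMass_eq, ← sum_eval, div_mul_eq_mul_div]
  gcongr

theorem levelMass_eval_le_choose (l : ℕ) (T : ParityTree n) :
    levelMass l T.eval ≤ T.acceptProb * ((T.depth * l).choose l : ℝ) :=
  levelMass_eval_le_of_card_levelSets_le T fun _ hV => card_levelSets_le_choose hV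

theorem levelMass_eval_le_two_pow {l : ℕ} (hl : 1 ≤ l) (T : ParityTree n) :
    levelMass l T.eval ≤ T.acceptProb * ((2 : ℝ) ^ T.depth - 1) := by
  have h := levelMass_eval_le_of_card_levelSets_le (N := 2 ^ T.depth - 1) T
    fun _ hV => card_levelSets_le_two_pow hl hV
  rwa [Nat.cast_sub Nat.one_le_two_pow, Nat.cast_pow, Nat.cast_ofNat, Nat.cast_one] at h

lemma acceptProb_le_one (T : ParityTree n) : T.acceptProb ≤ 1 := by
  rw [ParityTree.acceptProb, div_le_one (by positivity)]
  have := card_le_univ (univ.filter fun x : SignCube n => T.output x = true)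
  rw [Fintype.card_pi_const, Fintype.card_units_int] at this
  exact_mod_cast this

lemma levelMass_eval_eq_zero_of_acceptProb_eq_one {l : ℕ} (hl : 1 ≤ l) (T : ParityTree n)
    (hT : T.acceptProb = 1) : levelMass l T.eval = 0 := by
  rw [ParityTree.acceptProb, div_eq_one_iff_eq (by positivity)] at hT
  have h : univ.filter (fun x : SignCube n => T.output x = true) = univ := by
    rw [← card_eq_iff_eq_univ, Fintype.card_pi_const, Fintype.card_units_int]
    exact_mod_cast hT
  rw [levelMass_eq, sum_eq_zero, zero_div]
  intro S hS
  rw [sum_eval_mul, h, sum_realChar_eq_zero, abs_zero]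
  rw [← card_pos, (mem_powersetCard.1 hS).2]
  omega

theorem levelMass_eval_pow_le {l m : ℕ} (hl : 1 ≤ l) (hm : 1 ≤ m) (T : ParityTree n)
    (hd : 1 ≤ T.depth) :
    levelMass l T.eval ^ (2 * m) ≤ T.acceptProb ^ (2 * m - 1) *
      (3 ^ m * ((1 + (2 * m * l * T.depth : ℕ)) * (8 * m)) ^ (m * l) * (n : ℝ) ^ l) := by
  set s := 2 * m * l * T.depth with hs
  have hs1 : 1 ≤ s := by
    rw [hs]
    exact Nat.mul_pos (Nat.mul_pos (by omega) hl) hd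
  have hD : (0 : ℝ) < s := by exact_mod_cast hs1
  set c : Finset (Fin n) → ℝ := fun S => ∑ x, T.eval x * realChar S x with hc
  set a : Finset (Fin n) → ℝ := fun S => if 0 ≤ c S then 1 else -1 with ha
  have ha1 : ∀ S, |a S| ≤ 1 := by
    intro S; simp only [ha]; split_ifs <;> simp
  have hac : ∀ S, a S * c S = |c S| := by
    intro S
    simp only [ha]
    split_ifs with h
    · rw [one_mul, abs_of_nonneg h]
    · rw [abs_of_neg (not_le.1 h)]; ring
  obtain ⟨g, hg1, hg2⟩ := exists_sum_eval_eq_and_sum_pow_le (a := a) (l := l) hm hD T univ ⊥ ∅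
    isAffine_univ (isClean_bot _) s (by simp [hs])
  have hM : ∑ S ∈ powersetCard l univ, |c S| =
      ∑ x ∈ univ.filter (fun x => T.output x = true), g x := by
    rw [← sum_eval_mul, ← hg1]
    simp only [mul_sum]
    rw [sum_comm]
    refine sum_congr rfl fun S _ => ?_
    rw [← hac, hc, mul_sum]
    exact sum_congr rfl fun x _ => by ring
  have hpot : ∑ x, g x ^ (2 * m) ≤ 2 ^ n * (sameLevelFactor m s ^ s *
      (s * lowerLevelFactor m s) ^ l * (n : ℝ) ^ l) := by
    refine hg2.trans ((sum_le_sum fun x _ =>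
      potential_empty_le hm hD ha1 s l 0 (zero_add l) x).trans (le_of_eq ?_))
    rw [sum_const, card_univ, Fintype.card_pi_const, Fintype.card_units_int, nsmul_eq_mul]
    push_cast
    rfl
  -- The choice D = s keeps the growth (1 + 1/s)^s of the same-level term below e.
  have hsame : sameLevelFactor m s ^ s ≤ 3 ^ m := by
    have h1 : (1 + 1 / (s : ℝ)) ^ s ≤ 3 := by
      calc (1 + 1 / (s : ℝ)) ^ s ≤ Real.exp (1 / s) ^ s := by
            gcongr
            rw [add_comm]
            exact Real.add_one_le_exp _
        _ = Real.exp 1 := by rw [← Real.exp_nat_mul, mul_one_div_cancel hD.ne']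
        _ ≤ 3 := Real.exp_one_lt_d9.le.trans (by norm_num)
    rw [sameLevelFactor, ← pow_mul, mul_comm, pow_mul]
    exact pow_le_pow_left₀ (by positivity) h1 m
  have hlower : s * lowerLevelFactor m s ≤ ((1 + (s : ℝ)) * (8 * m)) ^ m := by
    obtain ⟨k, rfl⟩ : ∃ k, m = k + 1 := ⟨m - 1, by omega⟩
    have h1 : (s : ℝ) * (1 + s) ^ k ≤ (1 + s) ^ (k + 1) := by
      rw [pow_succ']
      gcongr
      linarith
    rw [lowerLevelFactor, Nat.add_sub_cancel, ← mul_assoc, mul_pow (1 + (s : ℝ))]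
    gcongr
  have hlower0 : 0 ≤ s * lowerLevelFactor m s :=
    mul_nonneg hD.le (lowerLevelFactor_nonneg m hD)
  set A := univ.filter (fun x => T.output x = true)
  -- Jensen on the accepted inputs; the even power allows the sum to be extended to the whole cube.
  have hJ : (∑ x ∈ A, g x) ^ (2 * m) ≤ (A.card : ℝ) ^ (2 * m - 1) * ∑ x, g x ^ (2 * m) := by
    have h0 := pow_sum_le_card_mul_sum_pow (s := A) (f := fun x => |g x|)
      (fun _ _ => abs_nonneg _) (2 * m - 1)
    rw [show 2 * m - 1 + 1 = 2 * m by omega] at h0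
    have hev : Even (2 * m) := even_two_mul m
    simp only [hev.pow_abs] at h0
    calc (∑ x ∈ A, g x) ^ (2 * m) = |∑ x ∈ A, g x| ^ (2 * m) := (hev.pow_abs _).symm
      _ ≤ (∑ x ∈ A, |g x|) ^ (2 * m) := by gcongr; exact abs_sum_le_sum_abs _ _
      _ ≤ _ := h0
      _ ≤ _ := mul_le_mul_of_nonneg_left (sum_le_sum_of_subset_of_nonneg (subset_univ _)
        fun x _ _ => hev.pow_nonneg _) (by positivity)
  have hp : T.acceptProb = (A.card : ℝ) / 2 ^ n := rfl
  have h2 : ((2 : ℝ) ^ n) ^ (2 * m) = (2 ^ n) ^ (2 * m - 1) * 2 ^ n := by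
    rw [← pow_succ, show 2 * m - 1 + 1 = 2 * m by omega]
  rw [levelMass_eq, hM, div_pow, hp, div_pow, h2, div_mul_eq_mul_div,
    div_le_div_iff₀ (by positivity) (by positivity)]
  calc (∑ x ∈ A, g x) ^ (2 * m) * (2 ^ n) ^ (2 * m - 1)
      ≤ ((A.card : ℝ) ^ (2 * m - 1) * (2 ^ n * (3 ^ m *
          (((1 + (s : ℝ)) * (8 * m)) ^ m) ^ l * (n : ℝ) ^ l))) * (2 ^ n) ^ (2 * m - 1) := by
        refine mul_le_mul_of_nonneg_right (hJ.trans ?_) (by positivity)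
        refine mul_le_mul_of_nonneg_left (hpot.trans ?_) (by positivity)
        gcongr
    _ = _ := by rw [← pow_mul]; ring

theorem levelMass_eval_le_sqrt_mul_logb {l : ℕ} (hl : 1 ≤ l) (hn : 2 ≤ n) (T : ParityTree n)
    (hd : 1 ≤ T.depth) (hp : 0 < T.acceptProb) :
    levelMass l T.eval ≤ T.acceptProb *
      (24 * (√(T.depth : ℝ) * Real.logb 2 ((n : ℝ) ^ l / T.acceptProb))) ^ l := by
  set p := T.acceptProb
  set d := T.depth
  set L := Real.logb 2 ((n : ℝ) ^ l / p) with hL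
  have hp1 : p ≤ 1 := acceptProb_le_one T
  have hl0 : (0 : ℝ) < l := by exact_mod_cast hl
  have hn0 : (0 : ℝ) < n := by exact_mod_cast (by omega : 0 < n)
  have hratio : (n : ℝ) ^ l / p = (2 : ℝ) ^ L :=
    (Real.rpow_logb (by norm_num) (by norm_num) (by positivity)).symm
  have hlL : (l : ℝ) ≤ L := by
    rw [hL, Real.le_logb_iff_rpow_le (by norm_num) (by positivity), Real.rpow_natCast]
    calc (2 : ℝ) ^ l ≤ (n : ℝ) ^ l := by gcongr; exact_mod_cast hn
      _ ≤ (n : ℝ) ^ l / p := le_div_self (by positivity) hp hp1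
  -- The least m with n^l ≤ p 2^{ml}: the factor n^l then costs only a constant in the base and
  -- supplies the missing factor p. Rounding is harmless because L ≥ l.
  set m := ⌈L / l⌉₊
  have hLm : L ≤ m * l := (div_le_iff₀ hl0).1 (Nat.le_ceil _)
  have hm : 1 ≤ m := Nat.one_le_ceil_iff.2 (div_pos (hl0.trans_le hlL) hl0)
  have hmL : m * l ≤ 2 * L := by
    have := (Nat.ceil_lt_add_one (div_pos (hl0.trans_le hlL) hl0).le).le
    calc (m : ℝ) * l ≤ (L / l + 1) * l := by gcongr
      _ = L + l := by field_simp
      _ ≤ 2 * L := by linarith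
  have hmain := levelMass_eval_pow_le (m := m) hl hm T hd
  set M := levelMass l T.eval
  have hd1 : (1 : ℝ) ≤ d := by exact_mod_cast hd
  have hm1 : (1 : ℝ) ≤ m := by exact_mod_cast hm
  have hl1 : (1 : ℝ) ≤ l := by exact_mod_cast hl
  have hn2 : (n : ℝ) ^ l ≤ p * 2 ^ (m * l) := by
    rw [mul_comm, ← div_le_iff₀ hp, hratio, ← Real.rpow_natCast]
    exact Real.rpow_le_rpow_of_exponent_le (by norm_num) (by push_cast; exact hLm)
  have hbase : 3 * ((1 + (2 * m * l * d : ℕ)) * (8 * m)) * 2 ≤ (24 * (√(d : ℝ) * L)) ^ 2 := by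
    have hml1 : (1 : ℝ) ≤ m * l * d := by
      calc (1 : ℝ) = 1 * 1 * 1 := by norm_num
        _ ≤ m * l * d := by gcongr
    have hml : (m : ℝ) ≤ m * l := le_mul_of_one_le_right (by positivity) hl1
    calc (3 : ℝ) * ((1 + (2 * m * l * d : ℕ)) * (8 * m)) * 2
        = (1 + 2 * (m * l * d)) * (48 * m) := by push_cast; ring
      _ ≤ (3 * (m * l * d)) * (48 * (m * l)) := by gcongr; linarith
      _ = 144 * d * (m * l) ^ 2 := by ring
      _ ≤ 144 * d * (2 * L) ^ 2 := by gcongr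
      _ = 24 ^ 2 * (√(d : ℝ) ^ 2) * L ^ 2 := by rw [Real.sq_sqrt (by positivity)]; ring
      _ = _ := by ring
  have hL0 : 0 ≤ L := hl0.le.trans hlL
  refine le_of_pow_le_pow_left₀ (n := 2 * m) (by omega) (by positivity) ?_
  calc M ^ (2 * m) ≤ p ^ (2 * m - 1) *
        (3 ^ m * ((1 + (2 * m * l * d : ℕ)) * (8 * m)) ^ (m * l) * (n : ℝ) ^ l) := hmain
    _ ≤ p ^ (2 * m - 1) * (3 ^ (m * l) * ((1 + (2 * m * l * d : ℕ)) * (8 * m)) ^ (m * l) *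
          (p * 2 ^ (m * l))) := by
        gcongr
        · norm_num
        · exact Nat.le_mul_of_pos_right m hl
    _ = p ^ (2 * m - 1 + 1) * (3 * ((1 + (2 * m * l * d : ℕ)) * (8 * m)) * 2) ^ (m * l) := by
        rw [mul_pow _ (2 : ℝ), mul_pow (3 : ℝ), pow_succ]; ring
    _ ≤ p ^ (2 * m - 1 + 1) * ((24 * (√(d : ℝ) * L)) ^ 2) ^ (m * l) := by gcongr
    _ = (p * (24 * (√(d : ℝ) * L)) ^ l) ^ (2 * m) := by
        generalize 24 * (√(d : ℝ) * L) = K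
        rw [show 2 * m - 1 + 1 = 2 * m by omega, mul_pow, ← pow_mul, ← pow_mul]
        congr 2; ring

end LevelMass

/-! ### The bound free of p, and the one-variable case -/

section FinalBound

lemma mul_logb_inv_le_two {u : ℝ} (hu : 0 < u) : u * Real.logb 2 u⁻¹ ≤ 2 := by
  have h1 := Real.one_sub_inv_le_log_of_pos hu
  have h2 : u * -Real.log u ≤ 1 := by
    have := mul_le_mul_of_nonneg_left h1 hu.le
    rw [mul_sub, mul_inv_cancel₀ hu.ne'] at this
    linarith
  have h3 := Real.log_two_gt_d9
  rw [Real.logb, Real.log_inv, ← mul_div_assoc, div_le_iff₀ (by linarith)]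
  linarith

/-- The factor p moves inside the power as u = p^{1/l}. Then u log(1/u) ≤ 2 ≤ 2 log n absorbs the
dependence on p, and 72 = 24 · 3. -/
lemma mul_pow_logb_le {n d l : ℕ} (hl : 1 ≤ l) (hn : 2 ≤ n) {p : ℝ} (hp : 0 < p) (hp1 : p ≤ 1) :
    p * (24 * (√(d : ℝ) * Real.logb 2 ((n : ℝ) ^ l / p))) ^ l ≤
      (72 * (√(d : ℝ) * l * Real.logb 2 n)) ^ l := by
  set u := p ^ (1 / (l : ℝ)) with hu
  have hl0 : (l : ℝ) ≠ 0 := by exact_mod_cast (by omega : l ≠ 0)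
  have hn0 : (0 : ℝ) < n := by exact_mod_cast (by omega : 0 < n)
  have hu0 : 0 < u := Real.rpow_pos_of_pos hp _
  have hu1 : u ≤ 1 := Real.rpow_le_one hp.le hp1 (by positivity)
  have hup : u ^ l = p := by
    rw [hu, ← Real.rpow_natCast, ← Real.rpow_mul hp.le, one_div_mul_cancel hl0, Real.rpow_one]
  have hlog : Real.logb 2 ((n : ℝ) ^ l / p) = l * (Real.logb 2 n + Real.logb 2 u⁻¹) := by
    rw [← hup, ← div_pow, Real.logb_pow, div_eq_mul_inv, Real.logb_mul hn0.ne' (by positivity)]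
  have hn1 : 1 ≤ Real.logb 2 n := by
    rw [Real.le_logb_iff_rpow_le (by norm_num) hn0, Real.rpow_one]
    exact_mod_cast hn
  have hu2 : 0 ≤ Real.logb 2 u⁻¹ :=
    Real.logb_nonneg (by norm_num) ((one_le_inv₀ hu0).2 hu1)
  have h1 := mul_logb_inv_le_two hu0
  have h2 : u * (Real.logb 2 n + Real.logb 2 u⁻¹) ≤ 3 * Real.logb 2 n := by
    have : u * Real.logb 2 n ≤ Real.logb 2 n := mul_le_of_le_one_left (by linarith) hu1
    linarith
  rw [hlog]
  nth_rewrite 1 [← hup]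
  rw [← mul_pow]
  refine pow_le_pow_left₀ (by positivity) ?_ l
  calc u * (24 * (√(d : ℝ) * (l * (Real.logb 2 n + Real.logb 2 u⁻¹))))
      = 24 * √(d : ℝ) * l * (u * (Real.logb 2 n + Real.logb 2 u⁻¹)) := by ring
    _ ≤ 24 * √(d : ℝ) * l * (3 * Real.logb 2 n) := by gcongr
    _ = _ := by ring

/-- With n = 1 the logarithm is only log(1/p), which may be below l. Either p = 1 and the mass is
zero, or p ≤ 1/2 and the logarithm is at least 1. -/
lemma levelMass_eval_le_of_one {l : ℕ} (hl : l = 1) (T : ParityTree 1) (hd : T.depth = 1)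
    (hp : 0 < T.acceptProb) :
    levelMass l T.eval ≤ T.acceptProb *
      (24 * (√(T.depth : ℝ) * Real.logb 2 (((1 : ℕ) : ℝ) ^ l / T.acceptProb))) ^ l := by
  subst hl
  simp only [hd, Nat.cast_one, Real.sqrt_one, one_mul, pow_one, one_div]
  rcases eq_or_ne T.acceptProb 1 with h1 | h1
  · rw [levelMass_eval_eq_zero_of_acceptProb_eq_one le_rfl T h1, h1]
    simp
  have hhalf : T.acceptProb ≤ 1 / 2 := by
    have hlt := lt_of_le_of_ne (acceptProb_le_one T) h1
    rw [ParityTree.acceptProb, div_lt_one (by norm_num), pow_one] at hlt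
    have hle : (univ.filter fun x : SignCube 1 => T.output x = true).card ≤ 1 :=
      Nat.lt_succ_iff.1 (by exact_mod_cast hlt)
    rw [ParityTree.acceptProb, pow_one]
    gcongr
    exact_mod_cast hle
  have hlog : 1 ≤ Real.logb 2 T.acceptProb⁻¹ := by
    rw [Real.le_logb_iff_rpow_le (by norm_num) (by positivity), Real.rpow_one,
      le_inv_comm₀ (by norm_num) hp]
    linarith
  have h := levelMass_eval_le_two_pow le_rfl T
  rw [hd] at h
  refine h.trans (mul_le_mul_of_nonneg_left ?_ hp.le)
  have h2 : (2 : ℝ) ^ 1 - 1 = 1 := by norm_num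
  linarith

end FinalBound

theorem theorem5p12 :
    ∃ C C' : ℝ, 0 < C ∧ 0 < C' ∧
      ∀ (n d l : ℕ) (T : ParityTree n), 1 ≤ l → max d l ≤ n →
        T.IsPDT → T.depth = d → 1 / 2 ^ d ≤ T.acceptProb →
        levelMass l T.eval ≤
            T.acceptProb *
              min ((d * l).choose l : ℝ)
                (min ((2 : ℝ) ^ d - 1)
                  ((C * (√(d : ℝ) * Real.logb 2 ((n : ℝ) ^ l / T.acceptProb))) ^ l)) ∧
          (2 ≤ n →
            T.acceptProb *
                min ((d * l).choose l : ℝ)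
                  (min ((2 : ℝ) ^ d - 1)
                    ((C * (√(d : ℝ) * Real.logb 2 ((n : ℝ) ^ l / T.acceptProb))) ^ l)) ≤
              (C' * (√(d : ℝ) * l * Real.logb 2 n)) ^ l) := by
  refine ⟨24, 72, by norm_num, by norm_num, ?_⟩
  rintro n d l T hl hn - rfl hp
  have hp0 : 0 < T.acceptProb := lt_of_lt_of_le (by positivity) hp
  refine ⟨?_, fun hn2 => ?_⟩
  · rw [mul_min_of_nonneg _ _ hp0.le, mul_min_of_nonneg _ _ hp0.le]
    refine le_min (levelMass_eval_le_choose l T) (le_min (levelMass_eval_le_two_pow hl T) ?_)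
    -- At depth zero the third bound is 0, and the bound by 2^0 - 1 = 0 already gives it.
    rcases Nat.eq_zero_or_pos T.depth with hd | hd
    · have h := levelMass_eval_le_two_pow hl T
      rw [hd] at h ⊢
      rw [pow_zero, sub_self, mul_zero] at h
      rw [Nat.cast_zero, Real.sqrt_zero, zero_mul, mul_zero, zero_pow (by omega), mul_zero]
      exact h
    · rcases Nat.lt_or_ge n 2 with hn2 | hn2
      · obtain rfl : n = 1 := by omega
        exact levelMass_eval_le_of_one (by omega) T (by omega) hp0
      · exact levelMass_eval_le_sqrt_mul_logb hl hn2 T hd hp0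
  · refine le_trans (mul_le_mul_of_nonneg_left ((min_le_right _ _).trans (min_le_right _ _))
      hp0.le) ?_
    exact mul_pow_logb_le hl hn2 hp0 (acceptProb_le_one T)
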